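/- We work in continuous logic. A (many-sorted) metric language $L$ has sorts $S$, each with a bound $B_S>0$ and a metric symbol $d_S$; function symbols (possibly of arity $0$), each with a domain (a finite sequence of sorts), a codomain (a sort) and a uniform continuity modulus; and relation symbols, each with a domain, a bound and a modulus. A modulus is a continuous increasing function $\delta:[0,1]\to[0,1]$ with $\delta(0)=0$ and $\delta(\varepsilon)>0$ for $\varepsilon>0$. In an $L$-structure $M$ every sort is a nonempty complete metric space of diameter at most $B_S$, and the symbols are interpreted by functions respecting the bounds and the moduli (if $d(a_i,b_i)<\delta(\varepsilon)$ for all $i$, then the values at $\bar a$ and $\bar b$ are at distance $\le\varepsilon$). Basic formulas are built from atomic formulas $R(\tau_1,\dots,\tau_k)$ and $d_S(\tau_1,\tau_2)$ by all continuous connectives $f:\mathbb R^k\to\mathbb R$ and by the quantifiers $\sup_x,\inf_x$. A theory $T$ is a set of sentences; its models are the structures in which all of them have value $0$. Let $T$ be a theory and $\bar x=(x_1,\dots,x_n)$ a finite tuple of sorted variables. A $T$-formula $\varphi(\bar x)$ is an element of the completion of the space of basic formulas in free variables $\bar x$ for the seminorm $\|\varphi\|_T=\sup\{|\varphi^M(\bar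 a)|: M\models T,\ \bar a\in M\}$; it is evaluated in models of $T$ by taking limits. $S_{\bar x}(T)$ is the set of complete types, that is, of functions $p=\mathrm{tp}^M(\bar a):\varphi\mapsto\varphi^M(\bar a)$ on $T$-formulas, where $M\models T$ and $\bar a\in M$; such an $\bar a$ is said to realize $p$ in $M$. The logic topology on $S_{\bar x}(T)$ is generated by the sets $\{p: r<p(\varphi)<s\}$, for $\varphi$ a $T$-formula and $r<s$ real. Tuples carry the maximum metric, and $d(p,q)$ is the infimum of $d(\bar a,\bar b)$ over all $M\models T$ and $\bar a,\bar b\in M$ realizing $p$ and $q$ respectively; it is $\infty$ if there are none, which cannot happen when $T$ is complete. The $\varepsilon$-ball around $p$ is $\{q: d(p,q)<\varepsilon\}$. The type $p$ is principal relative to $T$ if its set of realizations $p(M)=\{\bar a\in M:\mathrm{tp}^M(\bar a)=p\}$ is $T$-definable: there is a $T$-formula $\varphi(\bar x)$ such that $\varphi^M(\bar a)=d(\bar a,p(M))$ for all $M\models T$ and $\bar a\in M$. Here the distance to the empty set is the bound of the metric on tuples, $\max_i B_{S_i}$, where $S_i$ is the sort of $x_i$ (and $1$ if $n=0$). \textbf{Proposition.}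 For every theory $T$, every finite tuple $\bar x$ of sorted variables and every $p\in S_{\bar x}(T)$, the following are equivalent: \begin{enumerate} \item $p$ is principal relative to $T$. \item For every $\varepsilon>0$, the $\varepsilon$-ball around $p$ contains a neighbourhood of $p$ that is open in the logic topology. \item For every $\varepsilon>0$, the $\varepsilon$-ball around $p$ has nonempty interior in the logic topology. \end{enumerate} -/

import Mathlib

universe u

namespace ContLogic

noncomputable section

/-! ### Metric languages and metric structures -/

/-- A uniform continuity modulus: a continuous increasing function `δ : [0,1] → [0,1]` with
`δ 0 = 0` and `δ ε > 0` for `ε > 0`. -/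
structure Modulus where
  toFun : unitInterval → unitInterval
  continuous : Continuous toFun
  monotone : Monotone toFun
  map_zero : toFun 0 = 0
  pos : ∀ ε, 0 < ε → 0 < toFun ε

/-- A (many-sorted) metric language.  The symbols `d_S` for the metrics of the sorts are not listed
among the relation symbols: they are provided by a separate kind of atomic formula. -/
structure Language : Type (u + 1) where
  Sorts : Type u
  bound : Sorts → ℝ
  bound_pos : ∀ s, 0 < bound s
  Functions : Type u
  funArity : Functions → ℕ
  funDom : ∀ f, Fin (funArity f) → Sorts
  funCod : Functions → Sorts
  funModulus : Functions → Modulus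
  Relations : Type u
  relArity : Relations → ℕ
  relDom : ∀ R, Fin (relArity R) → Sorts
  relBound : Relations → ℝ
  relBound_pos : ∀ R, 0 < relBound R
  relModulus : Relations → Modulus

/-- A metric structure: each sort is a nonempty complete metric space of diameter at most the
prescribed bound, and the symbols are interpreted by functions that obey the prescribed bounds and
uniform continuity moduli. -/
structure MetricStructure (L : Language.{u}) : Type (u + 1) where
  carrier : L.Sorts → Type u
  metric : ∀ s, MetricSpace (carrier s)
  complete : ∀ s, CompleteSpace (carrier s)
  nonempty : ∀ s, Nonempty (carrier s)
  dist_le : ∀ s (x y : carrier s), dist x y ≤ L.bound s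
  funMap : ∀ f, (∀ i, carrier (L.funDom f i)) → carrier (L.funCod f)
  funMap_modulus : ∀ f (a b : ∀ i, carrier (L.funDom f i)) (ε : unitInterval), 0 < ε →
    (∀ i, dist (a i) (b i) < ((L.funModulus f).toFun ε : ℝ)) →
      dist (funMap f a) (funMap f b) ≤ (ε : ℝ)
  relMap : ∀ R, (∀ i, carrier (L.relDom R i)) → ℝ
  relMap_bound : ∀ R a, |relMap R a| ≤ L.relBound R
  relMap_modulus : ∀ R (a b : ∀ i, carrier (L.relDom R i)) (ε : unitInterval), 0 < ε →
    (∀ i, dist (a i) (b i) < ((L.relModulus R).toFun ε : ℝ)) →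
      |relMap R a - relMap R b| ≤ (ε : ℝ)

attribute [instance] MetricStructure.metric MetricStructure.complete MetricStructure.nonempty

variable {L : Language.{u}}

/-- Tuples from `M` sorted as `Γ`.  As a finite product it carries the maximum metric. -/
abbrev MetricStructure.Tuple (M : MetricStructure L) {n : ℕ} (Γ : Fin n → L.Sorts) : Type u :=
  ∀ i, M.carrier (Γ i)

/-- Put one more element in front of a tuple. -/
def MetricStructure.consTuple (M : MetricStructure L) {n : ℕ} {Γ : Fin n → L.Sorts} {s : L.Sorts}
    (b : M.carrier s) (a : M.Tuple Γ) : M.Tuple (Fin.cons s Γ : Fin (n + 1) → L.Sorts) :=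
  fun i => Fin.cases (motive := fun i => M.carrier ((Fin.cons s Γ : Fin (n + 1) → L.Sorts) i)) b a i

/-! ### Terms and basic formulas -/

/-- Terms whose variables are among `x_0, …, x_{n-1}`, where `x_i` has sort `Γ i`; the last index
is the sort of the value of the term. -/
inductive Term (L : Language.{u}) {n : ℕ} (Γ : Fin n → L.Sorts) : L.Sorts → Type u
  | var (i : Fin n) : Term L Γ (Γ i)
  | app (f : L.Functions) (ts : ∀ i, Term L Γ (L.funDom f i)) : Term L Γ (L.funCod f)

/-- Basic formulas whose free variables are among `x_0, …, x_{n-1}`, where `x_i` has sort `Γ i`.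
The quantifiers bind a new variable, which is put in front. -/
inductive BasicFormula (L : Language.{u}) : {n : ℕ} → (Fin n → L.Sorts) → Type u
  | rel {n : ℕ} {Γ : Fin n → L.Sorts} (R : L.Relations)
      (ts : ∀ i, Term L Γ (L.relDom R i)) : BasicFormula L Γ
  | dist {n : ℕ} {Γ : Fin n → L.Sorts} {s : L.Sorts} (t₁ t₂ : Term L Γ s) : BasicFormula L Γ
  | conn {n : ℕ} {Γ : Fin n → L.Sorts} {k : ℕ} (f : C(Fin k → ℝ, ℝ))
      (φs : Fin k → BasicFormula L Γ) : BasicFormula L Γ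
  | sup {n : ℕ} {Γ : Fin n → L.Sorts} (s : L.Sorts)
      (φ : BasicFormula L (Fin.cons s Γ : Fin (n + 1) → L.Sorts)) : BasicFormula L Γ
  | inf {n : ℕ} {Γ : Fin n → L.Sorts} (s : L.Sorts)
      (φ : BasicFormula L (Fin.cons s Γ : Fin (n + 1) → L.Sorts)) : BasicFormula L Γ

/-- The value of a term. -/
def Term.eval (M : MetricStructure L) {n : ℕ} {Γ : Fin n → L.Sorts} (a : M.Tuple Γ) :
    {s : L.Sorts} → Term L Γ s → M.carrier s
  | _, .var i => a i
  | _, .app f ts => M.funMap f (fun i => (ts i).eval M a)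

/-- The value of a basic formula. -/
def BasicFormula.eval (M : MetricStructure L) :
    {n : ℕ} → {Γ : Fin n → L.Sorts} → BasicFormula L Γ → M.Tuple Γ → ℝ
  | _, _, .rel R ts, a => M.relMap R (fun i => (ts i).eval M a)
  | _, _, .dist t₁ t₂, a => Dist.dist (t₁.eval M a) (t₂.eval M a)
  | _, _, .conn f φs, a => f (fun j => (φs j).eval M a)
  | _, _, .sup s φ, a => ⨆ b : M.carrier s, φ.eval M (M.consTuple b a)
  | _, _, .inf s φ, a => ⨅ b : M.carrier s, φ.eval M (M.consTuple b a)

/-- A basic formula is bounded, uniformly in all structures. -/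
theorem BasicFormula.exists_bound {n : ℕ} {Γ : Fin n → L.Sorts} (φ : BasicFormula L Γ) :
    ∃ B : ℝ, ∀ (M : MetricStructure L) (a : M.Tuple Γ), |φ.eval M a| ≤ B := by
  induction φ with
  | rel R ts => exact ⟨L.relBound R, fun M a => M.relMap_bound R _⟩
  | @dist n Γ s t₁ t₂ =>
    refine ⟨L.bound s, fun M a => ?_⟩
    simp only [BasicFormula.eval, abs_of_nonneg dist_nonneg]
    exact M.dist_le s _ _
  | @conn n Γ k f φs ih =>
    choose B hB using ih
    have hK : IsCompact (Set.univ.pi fun j : Fin k => Set.Icc (-B j) (B j)) :=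
      isCompact_univ_pi fun j => isCompact_Icc
    obtain ⟨C, hC⟩ := hK.exists_bound_of_continuousOn f.continuous.continuousOn
    refine ⟨C, fun M a => ?_⟩
    have := hC (fun j => (φs j).eval M a) (fun j _ => abs_le.mp (hB j M a))
    simpa [BasicFormula.eval, Real.norm_eq_abs] using this
  | sup s φ ih =>
    obtain ⟨B, hB⟩ := ih
    refine ⟨B, fun M a => ?_⟩
    have h := fun b => abs_le.mp (hB M (M.consTuple (s := s) b a))
    obtain ⟨b₀⟩ := M.nonempty s
    simp only [BasicFormula.eval]
    exact abs_le.mpr ⟨(h b₀).1.trans (le_ciSup ⟨B, by rintro _ ⟨b, rfl⟩; exact (h b).2⟩ b₀),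
      ciSup_le fun b => (h b).2⟩
  | inf s φ ih =>
    obtain ⟨B, hB⟩ := ih
    refine ⟨B, fun M a => ?_⟩
    have h := fun b => abs_le.mp (hB M (M.consTuple (s := s) b a))
    obtain ⟨b₀⟩ := M.nonempty s
    simp only [BasicFormula.eval]
    exact abs_le.mpr ⟨le_ciInf fun b => (h b).1,
      (ciInf_le ⟨-B, by rintro _ ⟨b, rfl⟩; exact (h b).1⟩ b₀).trans (h b₀).2⟩

/-- A function on a finite product that obeys a uniform continuity modulus is uniformly
continuous. -/
theorem Modulus.uniformContinuous (δ : Modulus) {k : ℕ} {X : Fin k → Type*}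
    [∀ i, MetricSpace (X i)] {Y : Type*} [PseudoMetricSpace Y] (g : (∀ i, X i) → Y)
    (h : ∀ (a b : ∀ i, X i) (ε : unitInterval), 0 < ε →
      (∀ i, dist (a i) (b i) < (δ.toFun ε : ℝ)) → dist (g a) (g b) ≤ (ε : ℝ)) :
    UniformContinuous g := by
  rw [Metric.uniformContinuous_iff]
  intro ε hε
  have hm : 0 < min (ε / 2) 1 := lt_min (by linarith) one_pos
  let e : unitInterval := ⟨min (ε / 2) 1, hm.le, min_le_right _ _⟩
  refine ⟨δ.toFun e, δ.pos e hm, fun {a b} hab => ?_⟩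
  refine (h a b e hm fun i => (dist_le_pi_dist a b i).trans_lt hab).trans_lt ?_
  exact (min_le_left (ε / 2) 1).trans_lt (by linarith)

theorem Term.uniformContinuous_eval (M : MetricStructure L) {n : ℕ} {Γ : Fin n → L.Sorts}
    {s : L.Sorts} (t : Term L Γ s) : UniformContinuous fun a : M.Tuple Γ => t.eval M a := by
  induction t with
  | var i => exact Pi.uniformContinuous_proj _ i
  | app f ts ih =>
    exact ((L.funModulus f).uniformContinuous (M.funMap f) (M.funMap_modulus f)).comp
      (uniformContinuous_pi.mpr ih)

theorem MetricStructure.dist_consTuple_le (M : MetricStructure L) {n : ℕ} {Γ : Fin n → L.Sorts}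
    {s : L.Sorts} (b : M.carrier s) (a a' : M.Tuple Γ) :
    dist (M.consTuple b a) (M.consTuple b a') ≤ dist a a' := by
  refine (dist_pi_le_iff dist_nonneg).mpr fun i => ?_
  induction i using Fin.cases with
  | zero => exact (dist_self b).trans_le dist_nonneg
  | succ i => exact dist_le_pi_dist a a' i

/-- A basic formula is interpreted by a uniformly continuous function. -/
theorem BasicFormula.uniformContinuous_eval (M : MetricStructure L) {n : ℕ}
    {Γ : Fin n → L.Sorts} (φ : BasicFormula L Γ) :
    UniformContinuous fun a : M.Tuple Γ => φ.eval M a := by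
  induction φ with
  | rel R ts =>
    exact ((L.relModulus R).uniformContinuous (M.relMap R) (M.relMap_modulus R)).comp
      (uniformContinuous_pi.mpr fun i => (ts i).uniformContinuous_eval M)
  | dist t₁ t₂ =>
    exact (t₁.uniformContinuous_eval M).dist (t₂.uniformContinuous_eval M)
  | @conn n Γ k f φs ih =>
    choose B hB using fun j => (φs j).exists_bound
    have hK : IsCompact (Set.univ.pi fun j : Fin k => Set.Icc (-B j) (B j)) :=
      isCompact_univ_pi fun j => isCompact_Icc
    have hf := hK.uniformContinuousOn_of_continuous f.continuous.continuousOn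
    rw [Metric.uniformContinuousOn_iff] at hf
    have hg := uniformContinuous_pi.mpr ih
    rw [Metric.uniformContinuous_iff] at hg ⊢
    intro ε hε
    obtain ⟨δ, hδ, h⟩ := hf ε hε
    obtain ⟨η, hη, h'⟩ := hg δ hδ
    exact ⟨η, hη, fun {a b} hab => h _ (fun j _ => abs_le.mp (hB j M a)) _
      (fun j _ => abs_le.mp (hB j M b)) (h' hab)⟩
  | sup s φ ih =>
    obtain ⟨B, hB⟩ := φ.exists_bound
    have hb : ∀ a, BddAbove (Set.range fun b => φ.eval M (M.consTuple (s := s) b a)) := fun a =>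
      ⟨B, by rintro _ ⟨b, rfl⟩; exact (abs_le.mp (hB M _)).2⟩
    rw [Metric.uniformContinuous_iff] at ih ⊢
    intro ε hε
    obtain ⟨δ, hδ, h⟩ := ih (ε / 2) (by linarith)
    have key : ∀ a a' : M.Tuple _, Dist.dist a a' < δ →
        (⨆ b, φ.eval M (M.consTuple (s := s) b a)) ≤
          (⨆ b, φ.eval M (M.consTuple (s := s) b a')) + ε / 2 := by
      intro a a' haa
      refine ciSup_le fun b => ?_
      have h1 := h ((M.dist_consTuple_le b a a').trans_lt haa)
      rw [Real.dist_eq] at h1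
      have h2 := le_ciSup (hb a') b
      have h3 := (abs_lt.mp h1).2
      linarith
    refine ⟨δ, hδ, fun {a a'} haa => ?_⟩
    simp only [BasicFormula.eval, Real.dist_eq]
    have h1 := key a a' haa
    have h2 := key a' a (by rwa [dist_comm])
    exact abs_lt.mpr ⟨by linarith, by linarith⟩
  | inf s φ ih =>
    obtain ⟨B, hB⟩ := φ.exists_bound
    have hb : ∀ a, BddBelow (Set.range fun b => φ.eval M (M.consTuple (s := s) b a)) := fun a =>
      ⟨-B, by rintro _ ⟨b, rfl⟩; exact (abs_le.mp (hB M _)).1⟩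
    rw [Metric.uniformContinuous_iff] at ih ⊢
    intro ε hε
    obtain ⟨δ, hδ, h⟩ := ih (ε / 2) (by linarith)
    have key : ∀ a a' : M.Tuple _, Dist.dist a a' < δ →
        (⨅ b, φ.eval M (M.consTuple (s := s) b a)) - ε / 2 ≤
          (⨅ b, φ.eval M (M.consTuple (s := s) b a')) := by
      intro a a' haa
      refine le_ciInf fun b => ?_
      have h1 := h ((M.dist_consTuple_le b a a').trans_lt haa)
      rw [Real.dist_eq] at h1
      have h2 := ciInf_le (hb a) b
      have h3 := (abs_lt.mp h1).2
      linarith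
    refine ⟨δ, hδ, fun {a a'} haa => ?_⟩
    simp only [BasicFormula.eval, Real.dist_eq]
    have h1 := key a a' haa
    have h2 := key a' a (by rwa [dist_comm])
    exact abs_lt.mpr ⟨by linarith, by linarith⟩

/-! ### Theories, models, elementary embeddings -/

/-- Sentences: formulas without free variables. -/
abbrev Sentence (L : Language.{u}) : Type u := BasicFormula L (Fin.elim0 : Fin 0 → L.Sorts)

/-- The value of a sentence. -/
def Sentence.value (M : MetricStructure L) (σ : Sentence L) : ℝ :=
  BasicFormula.eval M σ (fun i => i.elim0)

/-- A set of sentences.  (Satisfiability holds automatically as soon as there is a type.) -/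
abbrev Theory (L : Language.{u}) : Type u := Set (Sentence L)

/-- The models of `T`: the structures in which all sentences of `T` have value `0`. -/
abbrev Model (T : Theory L) : Type (u + 1) :=
  {M : MetricStructure L // ∀ σ ∈ T, Sentence.value M σ = 0}

/-- Elementary embeddings: families of maps that preserve the values of all formulas. -/
structure ElementaryEmbedding (M N : MetricStructure L) where
  toFun : ∀ s, M.carrier s → N.carrier s
  map_formula : ∀ {n : ℕ} {Γ : Fin n → L.Sorts} (φ : BasicFormula L Γ) (a : M.Tuple Γ),
    φ.eval N (fun i => toFun (Γ i) (a i)) = φ.eval M a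

/-! ### `T`-formulas -/

/-- The basic formulas in free variables sorted as `Γ`, with the pseudometric given by `T`. -/
structure BasicFormulaOver (T : Theory L) {n : ℕ} (Γ : Fin n → L.Sorts) : Type u where
  formula : BasicFormula L Γ

variable {T : Theory L} {n : ℕ} {Γ : Fin n → L.Sorts}

/-- The set of values of `|φ - ψ|` in models of `T` is bounded. -/
theorem bddAbove_abs_sub (φ ψ : BasicFormulaOver T Γ) :
    BddAbove (Set.range fun x : (M : Model T) × M.1.Tuple Γ =>
      |φ.formula.eval x.1.1 x.2 - ψ.formula.eval x.1.1 x.2|) := by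
  obtain ⟨B, hB⟩ := φ.formula.exists_bound
  obtain ⟨C, hC⟩ := ψ.formula.exists_bound
  refine ⟨B + C, ?_⟩
  rintro _ ⟨x, rfl⟩
  exact (abs_sub _ _).trans (add_le_add (hB _ _) (hC _ _))

/-- The distance of `φ` and `ψ` is `‖φ - ψ‖_T`, the supremum of `|φ - ψ|` over all tuples in all
models of `T`. -/
instance : PseudoMetricSpace (BasicFormulaOver T Γ) where
  dist φ ψ := ⨆ x : (M : Model T) × M.1.Tuple Γ,
    |φ.formula.eval x.1.1 x.2 - ψ.formula.eval x.1.1 x.2|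
  dist_self φ := by simp
  dist_comm φ ψ := by simp only [abs_sub_comm]
  dist_triangle φ ψ χ := by
    refine Real.iSup_le (fun x => ?_) (add_nonneg (Real.iSup_nonneg fun _ => abs_nonneg _)
      (Real.iSup_nonneg fun _ => abs_nonneg _))
    exact (abs_sub_le _ _ _).trans (add_le_add (le_ciSup (bddAbove_abs_sub φ ψ) x)
      (le_ciSup (bddAbove_abs_sub ψ χ) x))

variable (T Γ) in
/-- The `T`-formulas in free variables sorted as `Γ`: the completion of the space of basic formulas
with respect to `‖·‖_T`. -/
abbrev TFormula : Type u := UniformSpace.Completion (BasicFormulaOver T Γ)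

/-- The value of a `T`-formula in a model of `T`: the continuous extension of the evaluation of
basic formulas, that is, the limit of the values of basic formulas that converge to it. -/
def TFormula.eval (M : Model T) (φ : TFormula T Γ) (a : M.1.Tuple Γ) : ℝ :=
  UniformSpace.Completion.extension
    (fun ψ : BasicFormulaOver T Γ => ψ.formula.eval M.1 a) φ

theorem uniformContinuous_eval_over (M : Model T) (a : M.1.Tuple Γ) :
    UniformContinuous fun ψ : BasicFormulaOver T Γ => ψ.formula.eval M.1 a := by
  rw [Metric.uniformContinuous_iff]
  intro ε hε
  refine ⟨ε, hε, fun {φ ψ} h => lt_of_le_of_lt ?_ h⟩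
  rw [Real.dist_eq]
  exact le_ciSup (bddAbove_abs_sub φ ψ) (⟨M, a⟩ : (M : Model T) × M.1.Tuple Γ)

theorem TFormula.eval_coe (M : Model T) (ψ : BasicFormulaOver T Γ) (a : M.1.Tuple Γ) :
    TFormula.eval M (ψ : TFormula T Γ) a = ψ.formula.eval M.1 a :=
  UniformSpace.Completion.extension_coe (uniformContinuous_eval_over M a) ψ

theorem TFormula.continuous_eval_left (M : Model T) (a : M.1.Tuple Γ) :
    Continuous fun φ : TFormula T Γ => φ.eval M a :=
  UniformSpace.Completion.continuous_extension

theorem TFormula.abs_eval_sub_le (M : Model T) (φ ψ : TFormula T Γ) (a : M.1.Tuple Γ) :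
    |φ.eval M a - ψ.eval M a| ≤ dist φ ψ := by
  induction φ, ψ using UniformSpace.Completion.induction_on₂ with
  | hp =>
    exact isClosed_le (((continuous_eval_left M a).comp continuous_fst).sub
      ((continuous_eval_left M a).comp continuous_snd)).abs continuous_dist
  | ih φ ψ =>
    rw [eval_coe, eval_coe, UniformSpace.Completion.dist_eq]
    exact le_ciSup (bddAbove_abs_sub φ ψ) (⟨M, a⟩ : (M : Model T) × M.1.Tuple Γ)

/-- A `T`-formula is interpreted by a continuous function. -/
theorem TFormula.continuous_eval (M : Model T) (φ : TFormula T Γ) :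
    Continuous fun a : M.1.Tuple Γ => φ.eval M a := by
  refine continuous_of_uniform_approx_of_continuous fun V hV => ?_
  obtain ⟨ε, hε, hεV⟩ := Metric.mem_uniformity_dist.mp hV
  obtain ⟨_, ⟨ψ, rfl⟩, hψ⟩ :=
    Metric.mem_closure_iff.mp (UniformSpace.Completion.denseRange_coe φ) ε hε
  refine ⟨fun a => ψ.formula.eval M.1 a,
    (ψ.formula.uniformContinuous_eval M.1).continuous, fun a => hεV ?_⟩
  change dist (φ.eval M a) (ψ.formula.eval M.1 a) < ε
  rw [← TFormula.eval_coe, Real.dist_eq]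
  exact (abs_eval_sub_le M φ _ a).trans_lt hψ

theorem TFormula.eval_map {M N : Model T} (ρ : ElementaryEmbedding M.1 N.1) (φ : TFormula T Γ)
    (a : M.1.Tuple Γ) : φ.eval N (fun i => ρ.toFun (Γ i) (a i)) = φ.eval M a := by
  induction φ using UniformSpace.Completion.induction_on with
  | hp => exact isClosed_eq (continuous_eval_left N _) (continuous_eval_left M a)
  | ih φ => rw [eval_coe, eval_coe]; exact ρ.map_formula φ.formula a

/-! ### Types, the logic topology and the metric -/

/-- The function `φ ↦ φ^M(a)`. -/
def tp (M : Model T) (a : M.1.Tuple Γ) : TFormula T Γ → ℝ := fun φ => φ.eval M a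

variable (T Γ) in
/-- The space of complete types of `T` in variables sorted as `Γ`. -/
@[ext]
structure TypeSpace : Type u where
  val : TFormula T Γ → ℝ
  exists_realization : ∃ (M : Model T) (a : M.1.Tuple Γ), tp M a = val

/-- The set of realizations of the type `p` in `M`. -/
def TypeSpace.realizations (p : TypeSpace T Γ) (M : Model T) : Set (M.1.Tuple Γ) :=
  {a | tp M a = p.val}

/-- The logic topology, with the basic open sets `{p | p(φ) ∈ (r, s)}`. -/
instance TypeSpace.logicTopology : TopologicalSpace (TypeSpace T Γ) :=
  TopologicalSpace.generateFrom
    {U | ∃ (φ : TFormula T Γ) (r s : ℝ), r < s ∧ U = {p | p.val φ ∈ Set.Ioo r s}}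

/-- The distance of two types: the infimum of the distances of their realizations in a common model
of `T`; it is `∞` if they have no realizations in a common model (which cannot happen if `T` is
complete). -/
def TypeSpace.distance (p q : TypeSpace T Γ) : ENNReal :=
  ⨅ (M : Model T) (a ∈ p.realizations M) (b ∈ q.realizations M), edist a b

/-- The open `ε`-ball around `p`, for the distance of types. -/
def TypeSpace.ball (p : TypeSpace T Γ) (ε : ℝ) : Set (TypeSpace T Γ) :=
  {q | p.distance q < ENNReal.ofReal ε}

/-! ### Definable sets and principal types -/

variable (T Γ) in
/-- A `T`-functor: a closed set of tuples in each model of `T`, respected by elementary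
embeddings. -/
structure TFunctor where
  obj : ∀ M : Model T, Set (M.1.Tuple Γ)
  isClosed : ∀ M, IsClosed (obj M)
  map_mem : ∀ {M N : Model T} (ρ : ElementaryEmbedding M.1 N.1) (a : M.1.Tuple Γ),
    a ∈ obj M → (fun i => ρ.toFun (Γ i) (a i)) ∈ obj N

/-- The bound of the maximum metric on tuples sorted as `Γ`: the largest of the bounds of the sorts
that occur.  For the empty tuple, where there is none, the value is `1`. -/
def tupleBound : {n : ℕ} → (Γ : Fin n → L.Sorts) → ℝ
  | 0, _ => 1
  | _ + 1, Γ => ⨆ i, L.bound (Γ i)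

open Classical in
/-- The distance from a tuple to a set of tuples.  The distance to the empty set is the bound of the
metric. -/
def distTo (M : MetricStructure L) (a : M.Tuple Γ) (X : Set (M.Tuple Γ)) : ℝ :=
  if X.Nonempty then Metric.infDist a X else tupleBound Γ

/-- A `T`-functor is a `T`-definable set if the distance to it is given by a `T`-formula. -/
def TFunctor.IsDefinable (X : TFunctor T Γ) : Prop :=
  ∃ φ : TFormula T Γ, ∀ (M : Model T) (a : M.1.Tuple Γ), φ.eval M a = distTo M.1 a (X.obj M)

/-- The `T`-functor that sends a model to the set of realizations of `p`. -/
def TypeSpace.realizationFunctor (p : TypeSpace T Γ) : TFunctor T Γ where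
  obj M := p.realizations M
  isClosed M := by
    have : p.realizations M = ⋂ φ : TFormula T Γ, {a | φ.eval M a = p.val φ} := by
      ext a
      simp [TypeSpace.realizations, tp, funext_iff]
    rw [this]
    exact isClosed_iInter fun φ => isClosed_eq (φ.continuous_eval M) continuous_const
  map_mem {M N} ρ a ha := by
    refine Eq.trans (funext fun φ => ?_) ha
    exact TFormula.eval_map ρ φ a

/-- A type is principal if its set of realizations is a `T`-definable set. -/
def TypeSpace.IsPrincipal (p : TypeSpace T Γ) : Prop := p.realizationFunctor.IsDefinable

end

end ContLogic

namespace ContLogic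

noncomputable section

variable {L : Language.{u}}

/-! ### Substitution -/

/-! If the distance to the realizations of `p` is a `T`-formula, that formula vanishes at `p`. Where
it is small, a realization lies close by in the same model, so it cuts out an open set inside the
ball. The substantial direction is from fat balls to definability.

The difficulty there is that closeness of types is witnessed in an unknown model, while definability
concerns every model. Instead of passing to elementary extensions, the proof uses inf-convolutions
`inf_b g(ψ(b), d(a, b))`. These are basic formulas, so "some tuple near `a` makes `ψ` small" depends
only on the type of `a` and can be carried from one model to another (`exists_infConvolution`,
`eval_eq_of_tp_eq`).

For radius `2⁻ʲ`, a formula isolating a point in the interior of the ball is convolved into a `χ j`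
that is at most `0` at `p`. In any model, `χ j (c) < 1` yields a nearby `b` whose type is in the
ball. Transferring `χ (j+1)` along that ball gives, near `b` in the same model, a tuple with `χ
(j+1) < 1`. Iterating produces a Cauchy sequence; by completeness it converges, and uniform
continuity with moduli common to all structures makes the limit realize `p`. Thus `χ k < 1` forces
proximity to an actual realization in the given model.

A last inf-convolution, penalizing `χ k`, approximates the distance to the realizations uniformly
over all models, including those omitting `p`. The uniform limit of these approximations is the
required `T`-formula. -/

/-- Simultaneous substitution of terms for the variables of a term. -/
def Term.subst {n m : ℕ} {Γ : Fin n → L.Sorts} {Δ : Fin m → L.Sorts}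
    (σ : ∀ i, Term L Δ (Γ i)) : {s : L.Sorts} → Term L Γ s → Term L Δ s
  | _, .var i => σ i
  | _, .app f ts => .app f (fun i => (ts i).subst σ)

theorem Term.eval_subst (M : MetricStructure L) {n m : ℕ} {Γ : Fin n → L.Sorts}
    {Δ : Fin m → L.Sorts} (σ : ∀ i, Term L Δ (Γ i)) (a : M.Tuple Δ) {s : L.Sorts}
    (t : Term L Γ s) : (t.subst σ).eval M a = t.eval M (fun i => (σ i).eval M a) := by
  induction t with
  | var i => rfl
  | app f ts ih => simp only [Term.subst, Term.eval, ih]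

/-- Add an unused variable in front of the context of a term. -/
def Term.weaken {n : ℕ} {Γ : Fin n → L.Sorts} (s' : L.Sorts) {s : L.Sorts} (t : Term L Γ s) :
    Term L (Fin.cons s' Γ : Fin (n + 1) → L.Sorts) s :=
  t.subst fun i => (.var i.succ : Term L (Fin.cons s' Γ : Fin (n + 1) → L.Sorts) _)

theorem Term.eval_weaken (M : MetricStructure L) {n : ℕ} {Γ : Fin n → L.Sorts} {s' s : L.Sorts}
    (t : Term L Γ s) (b : M.carrier s') (a : M.Tuple Γ) :
    (t.weaken s').eval M (M.consTuple b a) = t.eval M a :=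
  Term.eval_subst M _ _ t

/-- The substitution that fixes a new first variable and acts as `σ` on the other ones. -/
def liftSubst {n m : ℕ} {Γ : Fin n → L.Sorts} {Δ : Fin m → L.Sorts} (s : L.Sorts)
    (σ : ∀ i, Term L Δ (Γ i)) (i : Fin (n + 1)) :
    Term L (Fin.cons s Δ : Fin (m + 1) → L.Sorts) ((Fin.cons s Γ : Fin (n + 1) → L.Sorts) i) :=
  Fin.cases (motive := fun i => Term L (Fin.cons s Δ : Fin (m + 1) → L.Sorts)
      ((Fin.cons s Γ : Fin (n + 1) → L.Sorts) i))
    (.var (Γ := (Fin.cons s Δ : Fin (m + 1) → L.Sorts)) 0) (fun i => (σ i).weaken s) i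

theorem eval_liftSubst (M : MetricStructure L) {n m : ℕ} {Γ : Fin n → L.Sorts}
    {Δ : Fin m → L.Sorts} {s : L.Sorts} (σ : ∀ i, Term L Δ (Γ i)) (b : M.carrier s)
    (a : M.Tuple Δ) :
    (fun i => (liftSubst s σ i).eval M (M.consTuple b a)) =
      M.consTuple b (fun i => (σ i).eval M a) := by
  funext i
  induction i using Fin.cases with
  | zero => rfl
  | succ i => exact (σ i).eval_weaken M b a

/-- Simultaneous substitution of terms for the free variables of a basic formula. -/
def BasicFormula.subst : {n : ℕ} → {Γ : Fin n → L.Sorts} → BasicFormula L Γ →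
    {m : ℕ} → {Δ : Fin m → L.Sorts} → (∀ i, Term L Δ (Γ i)) → BasicFormula L Δ
  | _, _, .rel R ts, _, _, σ => .rel R (fun i => (ts i).subst σ)
  | _, _, .dist t₁ t₂, _, _, σ => .dist (t₁.subst σ) (t₂.subst σ)
  | _, _, .conn f φs, _, _, σ => .conn f (fun j => (φs j).subst σ)
  | _, _, .sup s φ, _, _, σ => .sup s (φ.subst (liftSubst s σ))
  | _, _, .inf s φ, _, _, σ => .inf s (φ.subst (liftSubst s σ))

theorem BasicFormula.eval_subst (M : MetricStructure L) {n : ℕ} {Γ : Fin n → L.Sorts}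
    (φ : BasicFormula L Γ) {m : ℕ} {Δ : Fin m → L.Sorts} (σ : ∀ i, Term L Δ (Γ i))
    (a : M.Tuple Δ) : (φ.subst σ).eval M a = φ.eval M (fun i => (σ i).eval M a) := by
  induction φ generalizing m with
  | rel R ts => simp only [subst, eval, Term.eval_subst]
  | dist t₁ t₂ => simp only [subst, eval, Term.eval_subst]
  | conn f φs ih => simp only [subst, eval, ih]
  | sup s φ ih => simp only [subst, eval, ih, eval_liftSubst]
  | inf s φ ih => simp only [subst, eval, ih, eval_liftSubst]

/-! ### Quantification over tuples -/

/-- The context `Γ` followed by `Δ`. -/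
def appendCtx {m : ℕ} (Δ : Fin m → L.Sorts) : {n : ℕ} → (Fin n → L.Sorts) → Fin (m + n) → L.Sorts
  | 0, _ => Δ
  -- The index is `m + n` although `Γ` comes first, because `m + (n + 1)` reduces to `(m + n) + 1`
  -- and no cast is needed.
  | n + 1, Γ => (Fin.cons (Γ 0) (appendCtx Δ (fun i : Fin n => Γ i.succ)) :
      Fin (m + n + 1) → L.Sorts)

/-- The tuple `b` followed by `a`. -/
def MetricStructure.appendTuple (M : MetricStructure L) {m : ℕ} {Δ : Fin m → L.Sorts}
    (a : M.Tuple Δ) : {n : ℕ} → {Γ : Fin n → L.Sorts} → M.Tuple Γ → M.Tuple (appendCtx Δ Γ)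
  | 0, _, _ => a
  | n + 1, Γ, b => M.consTuple (b 0) (M.appendTuple a (Γ := fun i : Fin n => Γ i.succ)
      (fun i => b i.succ))

/-- The variables of the first part of a context. -/
def leftVar {m : ℕ} (Δ : Fin m → L.Sorts) : {n : ℕ} → (Γ : Fin n → L.Sorts) → (i : Fin n) →
    Term L (appendCtx Δ Γ) (Γ i)
  | 0, _, i => i.elim0
  | n + 1, Γ, i => Fin.cases (motive := fun i => Term L (appendCtx Δ Γ) (Γ i))
      (.var (Γ := (Fin.cons (Γ 0) (appendCtx Δ (fun i : Fin n => Γ i.succ)) :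
        Fin (m + n + 1) → L.Sorts)) 0)
      (fun i => (leftVar Δ (fun i : Fin n => Γ i.succ) i).weaken (Γ 0)) i

/-- The variables of the second part of a context. -/
def rightVar {m : ℕ} (Δ : Fin m → L.Sorts) : {n : ℕ} → (Γ : Fin n → L.Sorts) → (i : Fin m) →
    Term L (appendCtx Δ Γ) (Δ i)
  | 0, _, i => .var (Γ := Δ) i
  | n + 1, Γ, i => (rightVar Δ (fun i : Fin n => Γ i.succ) i).weaken (Γ 0)

theorem eval_leftVar (M : MetricStructure L) {m : ℕ} {Δ : Fin m → L.Sorts} (a : M.Tuple Δ)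
    {n : ℕ} {Γ : Fin n → L.Sorts} (b : M.Tuple Γ) (i : Fin n) :
    (leftVar Δ Γ i).eval M (M.appendTuple a b) = b i := by
  induction n with
  | zero => exact i.elim0
  | succ n ih =>
    induction i using Fin.cases with
    | zero => rfl
    | succ i => exact (Term.eval_weaken M _ _ _).trans (ih (fun i => b i.succ) i)

theorem eval_rightVar (M : MetricStructure L) {m : ℕ} {Δ : Fin m → L.Sorts} (a : M.Tuple Δ)
    {n : ℕ} {Γ : Fin n → L.Sorts} (b : M.Tuple Γ) (i : Fin m) :
    (rightVar Δ Γ i).eval M (M.appendTuple a b) = a i := by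
  induction n with
  | zero => rfl
  | succ n ih => exact (Term.eval_weaken M _ _ _).trans (ih (fun i => b i.succ))

/-- The infimum over the first part of a context. -/
def BasicFormula.infBlock {m : ℕ} {Δ : Fin m → L.Sorts} : {n : ℕ} → {Γ : Fin n → L.Sorts} →
    BasicFormula L (appendCtx Δ Γ) → BasicFormula L Δ
  | 0, _, φ => φ
  | n + 1, Γ, φ => infBlock (Γ := fun i : Fin n => Γ i.succ) (.inf (Γ 0) φ)

theorem BasicFormula.eval_infBlock_le (M : MetricStructure L) {m : ℕ} {Δ : Fin m → L.Sorts}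
    (a : M.Tuple Δ) {n : ℕ} {Γ : Fin n → L.Sorts} (φ : BasicFormula L (appendCtx Δ Γ))
    (b : M.Tuple Γ) : φ.infBlock.eval M a ≤ φ.eval M (M.appendTuple a b) := by
  induction n with
  | zero => exact le_rfl
  | succ n ih =>
    refine (ih (Γ := fun i => Γ i.succ) (.inf (Γ 0) φ) (fun i => b i.succ)).trans ?_
    obtain ⟨B, hB⟩ := φ.exists_bound
    exact ciInf_le ⟨-B, by rintro _ ⟨c, rfl⟩; exact (abs_le.mp (hB M _)).1⟩ (b 0)

theorem BasicFormula.exists_lt_of_eval_infBlock_lt (M : MetricStructure L) {m : ℕ}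
    {Δ : Fin m → L.Sorts} (a : M.Tuple Δ) {n : ℕ} {Γ : Fin n → L.Sorts}
    (φ : BasicFormula L (appendCtx Δ Γ)) {r : ℝ} (h : φ.infBlock.eval M a < r) :
    ∃ b : M.Tuple Γ, φ.eval M (M.appendTuple a b) < r := by
  induction n with
  | zero => exact ⟨fun i => i.elim0, h⟩
  | succ n ih =>
    -- The quantifier over the first variable is innermost, so the tail is chosen before the head.
    obtain ⟨b, hb⟩ := ih (Γ := fun i => Γ i.succ) (.inf (Γ 0) φ) h
    obtain ⟨c, hc⟩ := exists_lt_of_ciInf_lt hb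
    exact ⟨fun i => Fin.cases (motive := fun i => M.carrier (Γ i)) c b i, hc⟩

/-- The function `a ↦ inf_b g(ψ(b), d(a, b))` is given by a basic formula. -/
theorem BasicFormula.exists_infConvolution {n : ℕ} {Γ : Fin n → L.Sorts} (ψ : BasicFormula L Γ)
    (g : ℝ → ℝ → ℝ) (hg : Continuous fun x : ℝ × ℝ => g x.1 x.2) :
    ∃ χ : BasicFormula L Γ, ∀ (M : MetricStructure L) (a : M.Tuple Γ),
      (∀ b, χ.eval M a ≤ g (ψ.eval M b) (Dist.dist a b)) ∧
      ∀ r, χ.eval M a < r → ∃ b, g (ψ.eval M b) (Dist.dist a b) < r := by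
  -- Entry `0` receives the value of `ψ`, the others the coordinate distances; their sup norm is the
  -- maximum metric, also for `n = 0`.
  let f : C(Fin (n + 1) → ℝ, ℝ) :=
    ⟨fun v => g (v 0) ‖fun i : Fin n => v i.succ‖, hg.comp (by fun_prop :
      Continuous fun v : Fin (n + 1) → ℝ => (v 0, ‖fun i : Fin n => v i.succ‖))⟩
  let φ : BasicFormula L (appendCtx Γ Γ) := .conn f
    (Fin.cons (ψ.subst (leftVar Γ Γ)) fun i => .dist (rightVar Γ Γ i) (leftVar Γ Γ i))
  have hφ : ∀ (M : MetricStructure L) (a b : M.Tuple Γ),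
      φ.eval M (M.appendTuple a b) = g (ψ.eval M b) (Dist.dist a b) := by
    intro M a b
    have hd : Dist.dist a b = ‖fun i => Dist.dist (a i) (b i)‖ := by
      refine le_antisymm ((dist_pi_le_iff (norm_nonneg _)).mpr fun i => ?_)
        ((pi_norm_le_iff_of_nonneg dist_nonneg).mpr fun i => ?_)
      · exact (le_abs_self _).trans (norm_le_pi_norm (fun i => Dist.dist (a i) (b i)) i)
      · rw [Real.norm_eq_abs, abs_of_nonneg dist_nonneg]
        exact dist_le_pi_dist a b i
    simp only [φ, f, eval, ContinuousMap.coe_mk, Fin.cons_zero, Fin.cons_succ, eval_subst,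
      eval_leftVar, eval_rightVar, hd]
  refine ⟨φ.infBlock, fun M a => ⟨fun b => ?_, fun r hr => ?_⟩⟩
  · rw [← hφ]
    exact φ.eval_infBlock_le M a b
  · obtain ⟨b, hb⟩ := φ.exists_lt_of_eval_infBlock_lt M a hr
    exact ⟨b, by rwa [← hφ]⟩

/-! ### Uniform continuity across all structures -/

/-- A modulus only guarantees `≤ e`. Taking `e` strictly below `ε` gives the strict bounds that an
induction over terms and formulas passes on. -/
theorem Modulus.exists_uniform (δ : Modulus) {ε : ℝ} (hε : 0 < ε) :
    ∃ e : unitInterval, 0 < e ∧ (e : ℝ) < ε ∧ (0 : ℝ) < δ.toFun e := by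
  have hm : 0 < min (ε / 2) 1 := lt_min (by linarith) one_pos
  let e : unitInterval := ⟨min (ε / 2) 1, hm.le, min_le_right _ _⟩
  exact ⟨e, hm, (min_le_left (ε / 2) 1).trans_lt (by linarith), δ.pos e hm⟩

/-- Finitely many functions that are uniformly continuous uniformly in all structures have a common
modulus. -/
theorem exists_common_modulus {n k : ℕ} {Γ : Fin n → L.Sorts}
    (P : Fin k → ∀ M : MetricStructure L, M.Tuple Γ → M.Tuple Γ → Prop)
    (h : ∀ j, ∃ δ > 0, ∀ (M : MetricStructure L) (a b : M.Tuple Γ), dist a b < δ → P j M a b) :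
    ∃ δ > 0, ∀ (M : MetricStructure L) (a b : M.Tuple Γ), dist a b < δ → ∀ j, P j M a b := by
  choose δ hδ h using h
  obtain ⟨η, hη, hle⟩ : ∃ η > 0, ∀ j, η ≤ δ j := by
    -- `Option` adds the value `1`, so that the minimum exists even for `k = 0`.
    refine ⟨Finset.univ.inf' (Finset.univ_nonempty (α := Option (Fin k)))
      (fun o => o.elim 1 δ), ?_, fun j => ?_⟩
    · refine (Finset.lt_inf'_iff _).mpr fun o _ => ?_
      cases o with
      | none => exact one_pos
      | some j => exact hδ j
    · exact Finset.inf'_le (fun o : Option (Fin k) => o.elim 1 δ) (Finset.mem_univ (some j))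
  exact ⟨η, hη, fun M a b hab j => h j M a b (hab.trans_le (hle j))⟩

theorem Term.exists_uniform_modulus {n : ℕ} {Γ : Fin n → L.Sorts} {s : L.Sorts} (t : Term L Γ s)
    {ε : ℝ} (hε : 0 < ε) : ∃ δ > 0, ∀ (M : MetricStructure L) (a b : M.Tuple Γ),
      dist a b < δ → dist (t.eval M a) (t.eval M b) < ε := by
  induction t generalizing ε with
  | var i => exact ⟨ε, hε, fun M a b h => (dist_le_pi_dist a b i).trans_lt h⟩
  | app f ts ih =>
    obtain ⟨e, he, heε, hpos⟩ := (L.funModulus f).exists_uniform hε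
    obtain ⟨δ, hδ, h⟩ := exists_common_modulus _ fun j => ih j hpos
    exact ⟨δ, hδ, fun M a b hab => (M.funMap_modulus f _ _ e he (h M a b hab)).trans_lt heε⟩

/-- A basic formula is uniformly continuous, uniformly in all structures. -/
theorem BasicFormula.exists_uniform_modulus {n : ℕ} {Γ : Fin n → L.Sorts} (φ : BasicFormula L Γ)
    {ε : ℝ} (hε : 0 < ε) : ∃ δ > 0, ∀ (M : MetricStructure L) (a b : M.Tuple Γ),
      Dist.dist a b < δ → |φ.eval M a - φ.eval M b| < ε := by
  induction φ generalizing ε with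
  | rel R ts =>
    obtain ⟨e, he, heε, hpos⟩ := (L.relModulus R).exists_uniform hε
    obtain ⟨δ, hδ, h⟩ := exists_common_modulus _ fun j => (ts j).exists_uniform_modulus hpos
    exact ⟨δ, hδ, fun M a b hab => (M.relMap_modulus R _ _ e he (h M a b hab)).trans_lt heε⟩
  | dist t₁ t₂ =>
    obtain ⟨δ₁, hδ₁, h₁⟩ := t₁.exists_uniform_modulus (half_pos hε)
    obtain ⟨δ₂, hδ₂, h₂⟩ := t₂.exists_uniform_modulus (half_pos hε)
    refine ⟨min δ₁ δ₂, lt_min hδ₁ hδ₂, fun M a b hab => ?_⟩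
    exact (dist_dist_dist_le _ _ _ _).trans_lt
      ((add_lt_add (h₁ M a b (hab.trans_le (min_le_left _ _)))
        (h₂ M a b (hab.trans_le (min_le_right _ _)))).trans_eq (add_halves ε))
  | @conn n Γ k f φs ih =>
    choose B hB using fun j => (φs j).exists_bound
    have hK : IsCompact (Set.univ.pi fun j : Fin k => Set.Icc (-B j) (B j)) :=
      isCompact_univ_pi fun j => isCompact_Icc
    have hf := hK.uniformContinuousOn_of_continuous f.continuous.continuousOn
    rw [Metric.uniformContinuousOn_iff] at hf
    obtain ⟨η, hη, h⟩ := hf ε hε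
    obtain ⟨δ, hδ, h'⟩ := exists_common_modulus _ fun j => ih j hη
    exact ⟨δ, hδ, fun M a b hab => h _ (fun j _ => abs_le.mp (hB j M a)) _
      (fun j _ => abs_le.mp (hB j M b)) ((dist_pi_lt_iff hη).mpr (h' M a b hab))⟩
  | sup s φ ih =>
    obtain ⟨B, hB⟩ := φ.exists_bound
    obtain ⟨δ, hδ, h⟩ := ih (half_pos hε)
    have key : ∀ (M : MetricStructure L) (a a' : M.Tuple _), Dist.dist a a' < δ →
        (⨆ b, φ.eval M (M.consTuple (s := s) b a)) ≤
          (⨆ b, φ.eval M (M.consTuple (s := s) b a')) + ε / 2 := by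
      intro M a a' haa
      refine ciSup_le fun b => ?_
      have h1 := (abs_lt.mp (h M _ _ ((M.dist_consTuple_le b a a').trans_lt haa))).2
      have h2 := le_ciSup (f := fun b => φ.eval M (M.consTuple (s := s) b a'))
        ⟨B, by rintro _ ⟨b, rfl⟩; exact (abs_le.mp (hB M _)).2⟩ b
      linarith
    refine ⟨δ, hδ, fun M a a' haa => ?_⟩
    simp only [BasicFormula.eval]
    have h1 := key M a a' haa
    have h2 := key M a' a (by rwa [dist_comm])
    exact abs_lt.mpr ⟨by linarith, by linarith⟩
  | inf s φ ih =>
    obtain ⟨B, hB⟩ := φ.exists_bound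
    obtain ⟨δ, hδ, h⟩ := ih (half_pos hε)
    have key : ∀ (M : MetricStructure L) (a a' : M.Tuple _), Dist.dist a a' < δ →
        (⨅ b, φ.eval M (M.consTuple (s := s) b a)) - ε / 2 ≤
          (⨅ b, φ.eval M (M.consTuple (s := s) b a')) := by
      intro M a a' haa
      refine le_ciInf fun b => ?_
      have h1 := (abs_lt.mp (h M _ _ ((M.dist_consTuple_le b a a').trans_lt haa))).2
      have h2 := ciInf_le (f := fun b => φ.eval M (M.consTuple (s := s) b a))
        ⟨-B, by rintro _ ⟨b, rfl⟩; exact (abs_le.mp (hB M _)).1⟩ b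
      linarith
    refine ⟨δ, hδ, fun M a a' haa => ?_⟩
    simp only [BasicFormula.eval]
    have h1 := key M a a' haa
    have h2 := key M a' a (by rwa [dist_comm])
    exact abs_lt.mpr ⟨by linarith, by linarith⟩

/-! ### Types -/

variable {T : Theory L} {n : ℕ} {Γ : Fin n → L.Sorts}

/-- A basic formula, viewed as a `T`-formula. -/
def BasicFormula.toTFormula (T : Theory L) (φ : BasicFormula L Γ) : TFormula T Γ :=
  ((⟨φ⟩ : BasicFormulaOver T Γ) : TFormula T Γ)

theorem BasicFormula.eval_toTFormula (M : Model T) (φ : BasicFormula L Γ) (a : M.1.Tuple Γ) :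
    (φ.toTFormula T).eval M a = φ.eval M.1 a :=
  TFormula.eval_coe M ⟨φ⟩ a

theorem BasicFormula.exists_dist_toTFormula_lt (φ : TFormula T Γ) {ε : ℝ} (hε : 0 < ε) :
    ∃ ψ : BasicFormula L Γ, Dist.dist φ (ψ.toTFormula T) < ε := by
  obtain ⟨_, ⟨ψ, rfl⟩, hψ⟩ :=
    Metric.mem_closure_iff.mp (UniformSpace.Completion.denseRange_coe φ) ε hε
  exact ⟨ψ.formula, hψ⟩

/-- The type of a tuple, as a point of the type space. -/
def TypeSpace.of (M : Model T) (a : M.1.Tuple Γ) : TypeSpace T Γ := ⟨tp M a, M, a, rfl⟩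

/-- This is the bridge between models: applied to an inf-convolution, it transfers the existence of
nearby tuples without any map from one model to the other. -/
theorem eval_eq_of_tp_eq {M N : Model T} {a : M.1.Tuple Γ} {b : N.1.Tuple Γ} (h : tp M a = tp N b)
    (φ : BasicFormula L Γ) : φ.eval M.1 a = φ.eval N.1 b := by
  have := congrFun h (φ.toTFormula T)
  rwa [tp, tp, φ.eval_toTFormula, φ.eval_toTFormula] at this

/-- Basic formulas are dense and evaluation is continuous in the formula. -/
theorem tp_eq_of_eval_eq {M N : Model T} {a : M.1.Tuple Γ} {b : N.1.Tuple Γ}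
    (h : ∀ φ : BasicFormula L Γ, φ.eval M.1 a = φ.eval N.1 b) : tp M a = tp N b := by
  funext φ
  change φ.eval M a = φ.eval N b
  induction φ using UniformSpace.Completion.induction_on with
  | hp => exact isClosed_eq (TFormula.continuous_eval_left M a) (TFormula.continuous_eval_left N b)
  | ih φ => rw [TFormula.eval_coe, TFormula.eval_coe]; exact h φ.formula

theorem TypeSpace.abs_val_sub_le (p : TypeSpace T Γ) (φ ψ : TFormula T Γ) :
    |p.val φ - p.val ψ| ≤ dist φ ψ := by
  obtain ⟨M, a, h⟩ := p.exists_realization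
  rw [← h]
  exact TFormula.abs_eval_sub_le M φ ψ a

theorem TypeSpace.val_toTFormula {p : TypeSpace T Γ} {M : Model T} {a : M.1.Tuple Γ}
    (ha : a ∈ p.realizations M) (φ : BasicFormula L Γ) :
    p.val (φ.toTFormula T) = φ.eval M.1 a := by
  rw [← φ.eval_toTFormula]
  exact (congrFun ha _).symm

/-- An infimum below `ε` has a witness below `ε`, but there is no control over the model in which it
lives. -/
theorem TypeSpace.mem_ball {p q : TypeSpace T Γ} {ε : ℝ} (h : q ∈ p.ball ε) :
    ∃ (M : Model T) (a b : M.1.Tuple Γ), a ∈ p.realizations M ∧ b ∈ q.realizations M ∧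
      dist a b < ε := by
  simp only [ball, distance, Set.mem_ofPred_eq, iInf_lt_iff] at h
  obtain ⟨M, a, ha, b, hb, h⟩ := h
  refine ⟨M, a, b, ha, hb, ?_⟩
  rw [edist_dist] at h
  exact (ENNReal.ofReal_lt_ofReal_iff_of_nonneg dist_nonneg).mp h

theorem TypeSpace.mem_ball_of_dist_lt {p q : TypeSpace T Γ} {M : Model T} {a b : M.1.Tuple Γ}
    {ε : ℝ} (ha : a ∈ p.realizations M) (hb : b ∈ q.realizations M) (h : dist a b < ε) :
    q ∈ p.ball ε := by
  simp only [ball, distance, Set.mem_ofPred_eq, iInf_lt_iff]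
  refine ⟨M, a, ha, b, hb, ?_⟩
  rw [edist_dist]
  exact (ENNReal.ofReal_lt_ofReal_iff_of_nonneg dist_nonneg).mpr h

/-- Every neighbourhood of a type contains one that is defined by a single basic formula. -/
theorem TypeSpace.exists_basicFormula_nhds {U : Set (TypeSpace T Γ)} (hU : IsOpen U)
    {q : TypeSpace T Γ} (hq : q ∈ U) :
    ∃ ψ : BasicFormula L Γ, q.val (ψ.toTFormula T) = 0 ∧
      ∀ r : TypeSpace T Γ, r.val (ψ.toTFormula T) < 1 → r ∈ U := by
  induction hU generalizing q with
  | basic U h =>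
    obtain ⟨φ, r, s, hrs, rfl⟩ := h
    obtain ⟨h1, h2⟩ := hq
    -- A third of the margin: replacing `φ` by `θ` costs `δ` at `q` and again at the other type, and
    -- `θ` itself may vary by `δ`.
    let δ := min (q.val φ - r) (s - q.val φ) / 3
    have hδ : 0 < δ := div_pos (lt_min (by linarith) (by linarith)) three_pos
    have hδ1 : 3 * δ ≤ q.val φ - r := by
      simp only [δ]; linarith [min_le_left (q.val φ - r) (s - q.val φ)]
    have hδ2 : 3 * δ ≤ s - q.val φ := by
      simp only [δ]; linarith [min_le_right (q.val φ - r) (s - q.val φ)]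
    obtain ⟨θ, hθ⟩ := BasicFormula.exists_dist_toTFormula_lt φ hδ
    let c := q.val (θ.toTFormula T)
    let ψ : BasicFormula L Γ := .conn ⟨fun v : Fin 1 → ℝ => |v 0 - c| / δ, by fun_prop⟩ fun _ => θ
    have hψ : ∀ x : TypeSpace T Γ, x.val (ψ.toTFormula T) = |x.val (θ.toTFormula T) - c| / δ := by
      intro x
      obtain ⟨M, a, ha⟩ := x.exists_realization
      rw [val_toTFormula ha, val_toTFormula ha]
      rfl
    refine ⟨ψ, by simp [hψ, c], fun x hx => ?_⟩
    rw [hψ, div_lt_one hδ, abs_lt] at hx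
    have e1 := abs_le.mp (x.abs_val_sub_le φ (θ.toTFormula T))
    have e2 := abs_le.mp (q.abs_val_sub_le φ (θ.toTFormula T))
    exact ⟨by simp only [c] at hx; linarith, by simp only [c] at hx; linarith⟩
  | univ =>
    let ψ : BasicFormula L Γ := .conn ⟨fun _ : Fin 0 → ℝ => 0, by fun_prop⟩ fun i => i.elim0
    obtain ⟨M, a, ha⟩ := q.exists_realization
    exact ⟨ψ, by rw [val_toTFormula ha]; rfl, fun _ _ => trivial⟩
  | inter U V _ _ ihU ihV =>
    obtain ⟨ψ₁, h₁, h₁'⟩ := ihU hq.1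
    obtain ⟨ψ₂, h₂, h₂'⟩ := ihV hq.2
    let ψ : BasicFormula L Γ := .conn ⟨fun v : Fin 2 → ℝ => max (v 0) (v 1), by fun_prop⟩ ![ψ₁, ψ₂]
    have hψ : ∀ x : TypeSpace T Γ, x.val (ψ.toTFormula T) =
        max (x.val (ψ₁.toTFormula T)) (x.val (ψ₂.toTFormula T)) := by
      intro x
      obtain ⟨M, a, ha⟩ := x.exists_realization
      rw [val_toTFormula ha, val_toTFormula ha, val_toTFormula ha]
      rfl
    refine ⟨ψ, by rw [hψ, h₁, h₂, max_self], fun x hx => ?_⟩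
    rw [hψ, max_lt_iff] at hx
    exact ⟨h₁' x hx.1, h₂' x hx.2⟩
  | sUnion S _ ih =>
    obtain ⟨U, hUS, hqU⟩ := hq
    obtain ⟨ψ, h, h'⟩ := ih U hUS hqU
    exact ⟨ψ, h, fun x hx => ⟨U, hUS, h' x hx⟩⟩

/-! ### Realizations of types with fat balls -/

/-- If the type of `b` is `ε`-close to `p` and `θ` is at most `0` on `p`, then near `b`, in the same
model, `θ` is small. -/
theorem TypeSpace.exists_near_of_mem_ball {p : TypeSpace T Γ} {ε : ℝ} (hε : 0 < ε)
    {θ : BasicFormula L Γ} (hθ : p.val (θ.toTFormula T) ≤ 0) {N : Model T} {b : N.1.Tuple Γ}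
    (hb : of N b ∈ p.ball ε) : ∃ y : N.1.Tuple Γ, dist b y < 2 * ε ∧ θ.eval N.1 y < 1 := by
  -- A value below `1` yields a tuple within `2 * ε` at which `θ < 1`. At `c` the realization `a` of
  -- `p` witnesses such a value; equality of types moves it to `b`.
  obtain ⟨ω, hω⟩ := θ.exists_infConvolution (fun u t => max u (t / ε - 1)) (by fun_prop)
  obtain ⟨M, a, c, ha, hc, hac⟩ := mem_ball hb
  have h : ω.eval N.1 b < 1 := by
    rw [← eval_eq_of_tp_eq hc ω]
    refine ((hω M.1 c).1 a).trans_lt (max_lt ?_ ?_)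
    · rw [← val_toTFormula ha]
      linarith
    · rw [dist_comm]
      linarith [(div_lt_one hε).mpr hac]
  obtain ⟨y, hy⟩ := (hω N.1 b).2 1 h
  rw [max_lt_iff] at hy
  refine ⟨y, ?_, hy.1⟩
  rw [← div_lt_iff₀ hε]
  linarith

/-- If the `ε`-ball around `p` has interior, then some basic formula that vanishes on `p` forces a
tuple to be close to one whose type is in the ball. -/
theorem TypeSpace.exists_basicFormula_forces_near_ball {p : TypeSpace T Γ} {ε : ℝ} (hε : 0 < ε)
    (h : (interior (p.ball ε)).Nonempty) :
    ∃ χ : BasicFormula L Γ, p.val (χ.toTFormula T) ≤ 0 ∧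
      ∀ (N : Model T) (c : N.1.Tuple Γ), χ.eval N.1 c < 1 →
        ∃ b : N.1.Tuple Γ, dist c b < 2 * ε ∧ of N b ∈ p.ball ε := by
  obtain ⟨q, hq⟩ := h
  obtain ⟨ψ, hψ, hψ'⟩ := exists_basicFormula_nhds isOpen_interior hq
  obtain ⟨χ, hχ⟩ := ψ.exists_infConvolution (fun u t => max u (t / ε - 1)) (by fun_prop)
  refine ⟨χ, ?_, fun N c hc => ?_⟩
  · obtain ⟨M, a, b, ha, hb, hab⟩ := mem_ball (interior_subset hq)
    rw [val_toTFormula ha]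
    refine ((hχ M.1 a).1 b).trans (max_le ?_ ?_)
    · rw [← val_toTFormula hb, hψ]
    · linarith [(div_lt_one hε).mpr hab]
  · obtain ⟨b, hb⟩ := (hχ N.1 c).2 1 hc
    rw [max_lt_iff] at hb
    refine ⟨b, ?_, interior_subset (hψ' _ ?_)⟩
    · rw [← div_lt_iff₀ hε]
      linarith
    · rw [val_toTFormula (rfl : b ∈ (of N b).realizations N)]
      exact hb.1

/-- A limit of tuples whose types approach `p` realizes `p`. -/
theorem TypeSpace.mem_realizations_of_forall_near {p : TypeSpace T Γ} {N : Model T}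
    {y : N.1.Tuple Γ}
    (h : ∀ ε > 0, ∃ b : N.1.Tuple Γ, dist y b < ε ∧ of N b ∈ p.ball ε) :
    y ∈ p.realizations N := by
  obtain ⟨M₀, a₀, ha₀⟩ := p.exists_realization
  refine Eq.trans (tp_eq_of_eval_eq fun θ => ?_) ha₀
  refine eq_of_abs_sub_nonpos (le_of_forall_pos_lt_add fun η hη => ?_)
  -- The model `M` below is found only after `δ`, so `δ` has to serve all structures at once.
  obtain ⟨δ, hδ, hθ⟩ := θ.exists_uniform_modulus (half_pos hη)
  obtain ⟨b, hyb, hb⟩ := h δ hδ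
  obtain ⟨M, a, c, ha, hc, hac⟩ := mem_ball hb
  have h1 := hθ N.1 y b hyb
  have h2 := hθ M.1 a c hac
  rw [eval_eq_of_tp_eq hc θ, eval_eq_of_tp_eq (ha.trans ha₀.symm) θ, abs_sub_comm] at h2
  have h3 := abs_sub_le (θ.eval N.1 y) (θ.eval N.1 b) (θ.eval M₀.1 a₀)
  linarith

/-- If all balls around `p` have interior, then for all `k` some basic formula that vanishes on `p`
forces a tuple to be close to a realization of `p` in the same model. -/
theorem TypeSpace.exists_basicFormula_forces_near_realizations {p : TypeSpace T Γ}
    (h : ∀ ε : ℝ, 0 < ε → (interior (p.ball ε)).Nonempty) (k : ℕ) :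
    ∃ χ : BasicFormula L Γ, p.val (χ.toTFormula T) ≤ 0 ∧
      ∀ (N : Model T) (c : N.1.Tuple Γ), χ.eval N.1 c < 1 →
        ∃ y ∈ p.realizations N, dist c y ≤ 8 * (1 / 2) ^ k := by
  have hpos : ∀ j : ℕ, (0 : ℝ) < (1 / 2) ^ j := fun j => by positivity
  choose χ hχ hχ' using fun j => exists_basicFormula_forces_near_ball (hpos j) (h _ (hpos j))
  refine ⟨χ k, hχ k, fun N c hc => ?_⟩
  choose b hb hbp using hχ'
  -- Twice the radius leads from `x` to a tuple with type in the ball, and twice again to one where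
  -- `χ (j + 1) < 1`; both moves stay in `N`.
  have step : ∀ (j : ℕ) (x : {x : N.1.Tuple Γ // (χ j).eval N.1 x < 1}),
      ∃ y : {y : N.1.Tuple Γ // (χ (j + 1)).eval N.1 y < 1},
        dist x.1 y.1 < 4 * (1 / 2) ^ j := by
    intro j x
    obtain ⟨y, hy, hy'⟩ := exists_near_of_mem_ball (hpos j) (hχ (j + 1)) (hbp j N x.1 x.2)
    refine ⟨⟨y, hy'⟩, (dist_triangle _ (b j N x.1 x.2) _).trans_lt ?_⟩
    linarith [hb j N x.1 x.2]
  choose next hnext using step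
  let f : ∀ j, {x : N.1.Tuple Γ // (χ (k + j)).eval N.1 x < 1} := fun j =>
    Nat.rec (motive := fun j => {x : N.1.Tuple Γ // (χ (k + j)).eval N.1 x < 1}) ⟨c, hc⟩
      (fun j x => next (k + j) x) j
  -- The steps `4 * (1 / 2) ^ (k + j)` sum to `8 * (1 / 2) ^ k`, the total displacement from `c`.
  have hf : ∀ j, dist (f j).1 (f (j + 1)).1 ≤ (8 * (1 / 2) ^ k) / 2 / 2 ^ j := by
    intro j
    refine (hnext (k + j) (f j)).le.trans_eq ?_
    rw [pow_add, one_div_pow 2 j]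
    ring
  obtain ⟨y, hy⟩ := cauchySeq_tendsto_of_complete (cauchySeq_of_le_geometric_two hf)
  refine ⟨y, mem_realizations_of_forall_near fun ε hε => ?_,
    dist_le_of_le_geometric_two_of_tendsto₀ hf hy⟩
  have hlim : Filter.Tendsto (fun j => 2 * ((1 : ℝ) / 2) ^ (k + j)) Filter.atTop (nhds 0) := by
    have := ((tendsto_pow_atTop_nhds_zero_of_lt_one (r := (1 : ℝ) / 2) (by norm_num)
      (by norm_num)).comp (Filter.tendsto_add_atTop_nat k)).const_mul 2
    simpa [Function.comp_def, add_comm] using this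
  obtain ⟨j, hj1, hj2⟩ := ((hlim.eventually (gt_mem_nhds (half_pos hε))).and
    (Metric.tendsto_nhds.mp hy (ε / 2) (half_pos hε))).exists
  refine ⟨b (k + j) N (f j).1 (f j).2, ?_, ?_⟩
  · refine (dist_triangle _ (f j).1 _).trans_lt ?_
    rw [dist_comm] at hj2
    linarith [hb (k + j) N (f j).1 (f j).2]
  · refine lt_of_lt_of_le (hbp (k + j) N (f j).1 (f j).2) (ENNReal.ofReal_le_ofReal ?_)
    linarith [hpos (k + j)]

/-! ### Principal types -/

theorem tupleBound_pos (Γ : Fin n → L.Sorts) : 0 < tupleBound Γ := by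
  cases n with
  | zero => exact one_pos
  | succ n =>
    exact (L.bound_pos (Γ 0)).trans_le
      (le_ciSup (f := fun i => L.bound (Γ i)) (Set.finite_range _).bddAbove 0)

theorem dist_le_tupleBound (M : MetricStructure L) (a b : M.Tuple Γ) :
    dist a b ≤ tupleBound Γ := by
  refine (dist_pi_le_iff (tupleBound_pos Γ).le).mpr fun i => ?_
  cases n with
  | zero => exact i.elim0
  | succ n =>
    exact (M.dist_le _ _ _).trans
      (le_ciSup (f := fun i => L.bound (Γ i)) (Set.finite_range _).bddAbove i)

/-- If `χ` vanishes on `p` and `χ < 1` forces a tuple to be `η`-close to a realization of `p`, then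
the distance to the realizations of `p` is a basic formula up to an error `η`. -/
theorem TypeSpace.exists_basicFormula_near_distTo {p : TypeSpace T Γ} {η : ℝ} (hη : 0 ≤ η)
    {χ : BasicFormula L Γ} (hχ : p.val (χ.toTFormula T) ≤ 0)
    (h : ∀ (N : Model T) (c : N.1.Tuple Γ), χ.eval N.1 c < 1 →
      ∃ y ∈ p.realizations N, dist c y ≤ η) :
    ∃ Φ : BasicFormula L Γ, ∀ (N : Model T) (a : N.1.Tuple Γ),
      |Φ.eval N.1 a - distTo N.1 a (p.realizations N)| ≤ η := by
  -- The penalty vanishes on realizations of `p` and reaches the bound of the metric once `1 ≤ χ`.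
  -- Hence only tuples with `χ < 1`, which are `η`-close to a realization, can push the value below
  -- that bound.
  obtain ⟨Φ, hΦ⟩ := χ.exists_infConvolution
    (fun u t => min (tupleBound Γ) (t + tupleBound Γ * max 0 u)) (by fun_prop)
  have hB := tupleBound_pos Γ
  have hfar : ∀ u t : ℝ, 0 ≤ t → 1 ≤ u →
      tupleBound Γ ≤ min (tupleBound Γ) (t + tupleBound Γ * max 0 u) := by
    intro u t ht hu
    refine le_min le_rfl ?_
    nlinarith [le_max_right 0 u]
  refine ⟨Φ, fun N a => ?_⟩
  obtain ⟨h1, h2⟩ := hΦ N.1 a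
  unfold distTo
  split_ifs with hne
  · have upper : Φ.eval N.1 a ≤ Metric.infDist a (p.realizations N) := by
      refine (Metric.le_infDist hne).mpr fun y hy => (h1 y).trans ((min_le_right _ _).trans ?_)
      rw [← val_toTFormula hy, max_eq_left hχ]
      simp
    have lower : Metric.infDist a (p.realizations N) - η ≤ Φ.eval N.1 a := by
      refine le_of_forall_gt_imp_ge_of_dense fun r hr => ?_
      obtain ⟨y, hy⟩ := h2 r hr
      by_cases hlt : χ.eval N.1 y < 1
      · obtain ⟨z, hz, hyz⟩ := h N y hlt
        have e1 := (Metric.infDist_le_dist_of_mem (x := a) hz).trans (dist_triangle a y z)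
        have e2 : dist a y ≤ min (tupleBound Γ) (dist a y + tupleBound Γ * max 0 (χ.eval N.1 y)) :=
          le_min (dist_le_tupleBound _ _ _)
            (le_add_of_nonneg_right (mul_nonneg hB.le (le_max_left _ _)))
        linarith
      · obtain ⟨z, hz⟩ := hne
        have e1 := (Metric.infDist_le_dist_of_mem (x := a) hz).trans (dist_le_tupleBound _ a z)
        have e2 := hfar _ _ (dist_nonneg (x := a) (y := y)) (not_lt.mp hlt)
        linarith
    exact abs_le.mpr ⟨by linarith, by linarith⟩
  -- Without realizations every tuple is fully penalized, and the truncated infimum is exactly the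
  -- conventional distance to the empty set.
  · have hall : ∀ y, 1 ≤ χ.eval N.1 y := fun y => by
      by_contra hlt
      obtain ⟨z, hz, -⟩ := h N y (not_le.mp hlt)
      exact hne ⟨z, hz⟩
    have upper : Φ.eval N.1 a ≤ tupleBound Γ := (h1 a).trans (min_le_left _ _)
    have lower : tupleBound Γ ≤ Φ.eval N.1 a := by
      refine le_of_forall_gt_imp_ge_of_dense fun r hr => ?_
      obtain ⟨y, hy⟩ := h2 r hr
      exact (hfar _ _ dist_nonneg (hall y)).trans hy.le
    rw [le_antisymm upper lower, sub_self, abs_zero]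
    exact hη

/-- A uniform limit of basic formulas is a `T`-formula. -/
theorem exists_tFormula_of_uniform_approx (F : ∀ M : Model T, M.1.Tuple Γ → ℝ) (u : ℕ → ℝ)
    (hu : Filter.Tendsto u Filter.atTop (nhds 0)) (Φ : ℕ → BasicFormula L Γ)
    (h : ∀ k (M : Model T) (a : M.1.Tuple Γ), |(Φ k).eval M.1 a - F M a| ≤ u k) :
    ∃ φ : TFormula T Γ, ∀ (M : Model T) (a : M.1.Tuple Γ), φ.eval M a = F M a := by
  -- Absolute values keep the bound nonnegative even when `T` has no models, where the supremum is
  -- `0` by convention and `h` says nothing about `u`.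
  have hdist : ∀ k l, dist ((Φ k).toTFormula T) ((Φ l).toTFormula T) ≤ |u k| + |u l| := by
    intro k l
    unfold BasicFormula.toTFormula
    rw [UniformSpace.Completion.dist_eq]
    refine Real.iSup_le (fun x => ?_) (by positivity)
    refine (abs_sub_le _ (F x.1 x.2) _).trans (add_le_add ?_ ?_)
    · exact (h k x.1 x.2).trans (le_abs_self _)
    · rw [abs_sub_comm]
      exact (h l x.1 x.2).trans (le_abs_self _)
  have hc : CauchySeq fun k => (Φ k).toTFormula T := by
    rw [Metric.cauchySeq_iff]
    intro ε hε
    obtain ⟨K, hK⟩ := (Metric.tendsto_atTop.mp hu) (ε / 2) (half_pos hε)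
    refine ⟨K, fun k hk l hl => (hdist k l).trans_lt ?_⟩
    have h1 := hK k hk
    have h2 := hK l hl
    rw [Real.dist_0_eq_abs] at h1 h2
    linarith
  obtain ⟨φ, hφ⟩ := cauchySeq_tendsto_of_complete hc
  refine ⟨φ, fun M a => ?_⟩
  have h1 := ((TFormula.continuous_eval_left M a).tendsto φ).comp hφ
  have h2 : Filter.Tendsto (fun k => ((Φ k).toTFormula T).eval M a) Filter.atTop
      (nhds (F M a)) := by
    rw [tendsto_iff_dist_tendsto_zero]
    refine squeeze_zero (fun _ => dist_nonneg) (fun k => ?_) hu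
    rw [BasicFormula.eval_toTFormula, Real.dist_eq]
    exact h k M a
  exact tendsto_nhds_unique h1 h2

theorem TypeSpace.isPrincipal_of_interior_ball_nonempty {p : TypeSpace T Γ}
    (h : ∀ ε : ℝ, 0 < ε → (interior (p.ball ε)).Nonempty) : p.IsPrincipal := by
  choose χ hχ hχ' using exists_basicFormula_forces_near_realizations h
  choose Φ hΦ using fun k =>
    exists_basicFormula_near_distTo (by positivity : (0 : ℝ) ≤ 8 * (1 / 2) ^ k) (hχ k) (hχ' k)
  refine exists_tFormula_of_uniform_approx _ (fun k => 8 * (1 / 2) ^ k) ?_ Φ hΦ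
  simpa using (tendsto_pow_atTop_nhds_zero_of_lt_one (r := (1 : ℝ) / 2) (by norm_num)
    (by norm_num)).const_mul 8

theorem TypeSpace.IsPrincipal.exists_isOpen_subset_ball {p : TypeSpace T Γ} (hp : p.IsPrincipal)
    {ε : ℝ} (hε : 0 < ε) : ∃ U : Set (TypeSpace T Γ), IsOpen U ∧ p ∈ U ∧ U ⊆ p.ball ε := by
  obtain ⟨φ, hφ⟩ := hp
  -- Staying below `tupleBound Γ` excludes models that omit `p`; staying below `ε` then gives a
  -- realization at distance less than `ε`.
  have hm : 0 < min ε (tupleBound Γ) := lt_min hε (tupleBound_pos Γ)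
  refine ⟨{q | q.val φ ∈ Set.Ioo (-1) (min ε (tupleBound Γ))},
    TopologicalSpace.isOpen_generateFrom_of_mem ⟨φ, _, _, by linarith, rfl⟩, ?_, ?_⟩
  · obtain ⟨M, a, ha⟩ := p.exists_realization
    have hne : (p.realizations M).Nonempty := ⟨a, ha⟩
    have h0 : p.val φ = 0 := by
      rw [← ha]
      refine (hφ M a).trans ((if_pos hne).trans ?_)
      exact Metric.infDist_zero_of_mem ha
    rw [Set.mem_ofPred_eq, h0]
    exact ⟨by norm_num, hm⟩
  · rintro q ⟨-, hq⟩
    obtain ⟨M, b, hb⟩ := q.exists_realization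
    rw [← hb, tp, hφ M b] at hq
    change distTo M.1 b (p.realizations M) < _ at hq
    unfold distTo at hq
    split_ifs at hq with hne
    · obtain ⟨a, ha, hab⟩ := (Metric.infDist_lt_iff hne).mp (hq.trans_le (min_le_left _ _))
      rw [dist_comm] at hab
      exact mem_ball_of_dist_lt ha hb hab
    · exact absurd (hq.trans_le (min_le_right _ _)) (lt_irrefl _)

end

end ContLogic

theorem mainTheorem8 (L : ContLogic.Language.{u}) (T : ContLogic.Theory L) (n : ℕ)
    (Γ : Fin n → L.Sorts) (p : ContLogic.TypeSpace T Γ) :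
    List.TFAE [
      p.IsPrincipal,
      ∀ ε : ℝ, 0 < ε → ∃ U : Set (ContLogic.TypeSpace T Γ), IsOpen U ∧ p ∈ U ∧ U ⊆ p.ball ε,
      ∀ ε : ℝ, 0 < ε → (interior (p.ball ε)).Nonempty] := by
  tfae_have 1 → 2 := fun hp _ hε => hp.exists_isOpen_subset_ball hε
  tfae_have 2 → 3 := fun h ε hε => by
    obtain ⟨U, hU, hpU, hUε⟩ := h ε hε
    exact ⟨p, mem_interior.mpr ⟨U, hUε, hU, hpU⟩⟩
  tfae_have 3 → 1 := ContLogic.TypeSpace.isPrincipal_of_interior_ball_nonempty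
  tfae_finish
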